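/- Let $M$ be a smooth manifold, $A\to M$ a smooth real vector bundle of finite rank, $\Gamma(A)$ its space of smooth sections, $A^*$ the dual bundle, $\prec\cdot,\cdot\succ$ the duality pairing, and $\rho:A\to TM$ a bundle homomorphism (the anchor). A right-anchored product on $(A,M,\rho)$ is an $\mathbb R$-bilinear map $S:\Gamma(A)\times\Gamma(A)\to\Gamma(A)$, $(X,Y)\mapsto S_XY$, with $S_{fX}Y=fS_XY$ and $S_X(fY)=fS_XY+\rho(X)(f)Y$ for all $f\in C^\infty(M)$. Put $[X,Y]_S=S_XY-S_YX$ and $R^S(X,Y)Z=S_XS_YZ-S_YS_XZ-S_{[X,Y]_S}Z$; use the same notation for other products. One calls $(A,M,\rho,S)$ a left symmetric algebroid if $R^S=0$. The dual of $S$ is given by $\prec S_X^*\alpha,Y\succ=\rho(X).\prec\alpha,Y\succ-\prec\alpha,S_XY\succ$ for $\alpha\in\Gamma(A^*)$; likewise a right-anchored product $T$ on $(A^*,M,\rho_1)$ has a dual $T^*:\Gamma(A^*)\times\Gamma(A)\to\Gamma(A)$, $\prec\beta,T_\alpha^*X\succ=\rho_1(\alpha).\prec\beta,X\succ-\prec T_\alpha\beta,X\succ$.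 Two left symmetric algebroids $(A,M,\rho,S)$ and $(A^*,M,\rho_1,T)$ are compatible if, for all $X,Y\in\Gamma(A)$ and $\alpha,\beta\in\Gamma(A^*)$, $R^\nabla(X,\alpha)Y=R^\nabla(Y,\alpha)X$ and $R^\nabla(\alpha,X)\beta=R^\nabla(\beta,X)\alpha$, where $\nabla$ is the product on $\Gamma(A\oplus A^*)$ given by $\nabla_{X+\alpha}(Y+\beta)=S_XY+T^*_\alpha Y+S^*_X\beta+T_\alpha\beta$. Let $(A,M,\rho,S)$ be a left symmetric algebroid whose anchor $\rho$ is injective (on every fibre), and let $\mathrm r\in\Gamma(A\otimes A)$, viewed as a bilinear form on $A^*$, with skew-symmetric part $\mathfrak a(\alpha,\beta)=\tfrac12(\mathrm r(\alpha,\beta)-\mathrm r(\beta,\alpha))$. Let $\mathrm r_\#:A^*\to A$ be given by $\prec\beta,\mathrm r_\#(\alpha)\succ=\mathrm r(\alpha,\beta)$, put $\rho_{\mathrm r}=\rho\circ\mathrm r_\#$, and let $T$ be the right-anchored product on $(A^*,M,\rho_{\mathrm r})$ given by $$\prec T_\alpha\beta,X\succ=\rho(X).\mathrm r(\alpha,\beta)-\mathrm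 r(S_X^*\alpha,\beta)-\mathrm r(\alpha,S_X^*\beta)+\prec S^*_{\mathrm r_\#(\alpha)}\beta,X\succ .$$ For $\alpha,\beta\in\Gamma(A^*)$ and $X,Y\in\Gamma(A)$ put $\Delta(\mathrm r)(\alpha,\beta)=\mathrm r_\#([\alpha,\beta]_T)-[\mathrm r_\#(\alpha),\mathrm r_\#(\beta)]_S$ and $S^2_{X,Y}\mathfrak a=S_XS_Y\mathfrak a-S_{S_XY}\mathfrak a$, where $S_XB(\alpha,\beta)=\rho(X).B(\alpha,\beta)-B(S_X^*\alpha,\beta)-B(\alpha,S_X^*\beta)$ for bilinear $B$. Then $(A^*,M,\rho_{\mathrm r},T)$ is a left symmetric algebroid and $(A,M,\rho,S)$ and $(A^*,M,\rho_{\mathrm r},T)$ are compatible if and only if $$\Delta(\mathrm r)=0\quad\text{and}\quad S^2\mathfrak a=0 .$$ -/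

import Mathlib

open Bundle
open scoped Manifold ContDiff Topology
set_option maxSynthPendingDepth 3
set_option linter.unusedSectionVars false
namespace LSAlgebroid
noncomputable section

variable {E : Type*} [NormedAddCommGroup E] [NormedSpace ℝ E]
  {H : Type*} [TopologicalSpace H] {I : ModelWithCorners ℝ E H}
  {M : Type*} [TopologicalSpace M] [ChartedSpace H M]
  {F : Type*} [NormedAddCommGroup F] [NormedSpace ℝ F]
  {V : M → Type*} [TopologicalSpace (TotalSpace F V)] [∀ x, AddCommGroup (V x)]
  [∀ x, Module ℝ (V x)] [∀ x, TopologicalSpace (V x)] [∀ x, IsTopologicalAddGroup (V x)]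
  [∀ x, ContinuousSMul ℝ (V x)] [FiberBundle F V] [VectorBundle ℝ F V]
  {F' : Type*} [NormedAddCommGroup F'] [NormedSpace ℝ F']
  {W : M → Type*} [TopologicalSpace (TotalSpace F' W)] [∀ x, AddCommGroup (W x)]
  [∀ x, Module ℝ (W x)] [∀ x, TopologicalSpace (W x)] [∀ x, IsTopologicalAddGroup (W x)]
  [∀ x, ContinuousSMul ℝ (W x)] [FiberBundle F' W] [VectorBundle ℝ F' W]

/-- The fibres of the dual bundle `V*`. -/
abbrev Dual (V : M → Type*) [∀ x, AddCommGroup (V x)] [∀ x, Module ℝ (V x)]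
    [∀ x, TopologicalSpace (V x)] : M → Type _ := fun x => V x →L[ℝ] ℝ

variable (I F V) in
/-- `Γ(V)`: the smooth global sections of `V`. -/
abbrev Sec := Cₛ^∞⟮I; F, V⟯

variable (I F V) in
/-- `Γ(V*)`: the smooth global sections of the dual bundle. -/
abbrev DualSec := Sec I (F →L[ℝ] ℝ) (Dual V)

variable (I F V F' W) in
/-- Smooth vector bundle homomorphisms `V → W` over the identity of `M`: sections of `Hom(V, W)`. -/
abbrev BundleHom := Sec I (F →L[ℝ] F') (fun x => V x →L[ℝ] W x)

variable (I F V) in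
/-- `Γ(V ⊗ V)`: for a bundle of finite rank, `V ⊗ V` is the bundle of bilinear forms on `V*`. -/
abbrev BiTensor := Sec I ((F →L[ℝ] ℝ) →L[ℝ] (F →L[ℝ] ℝ) →L[ℝ] ℝ)
  (fun x => Dual V x →L[ℝ] Dual V x →L[ℝ] ℝ)

/-- The multiplication of a section by a smooth function. -/
instance : SMul C^∞⟮I, M; ℝ⟯ (Sec I F V) :=
  ⟨fun f s => ⟨fun x => f x • s x, f.contMDiff.smul_section s.contMDiff⟩⟩

@[simp]
theorem fun_smul_apply (f : C^∞⟮I, M; ℝ⟯) (s : Sec I F V) (x : M) : (f • s) x = f x • s x := rfl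

/-- `Γ(V)` is a module over `C^∞(M)`. -/
instance : Module C^∞⟮I, M; ℝ⟯ (Sec I F V) where
  one_smul s := by ext x; simp
  mul_smul f g s := by ext x; simp [mul_smul]
  smul_zero f := by ext x; simp
  smul_add f s t := by ext x; simp
  add_smul f g s := by ext x; simp [add_smul]
  zero_smul s := by ext x; simp

theorem sec_sum_apply {ι : Type*} (A : Finset ι) (s : ι → Sec I F V) (x : M) :
    (∑ i ∈ A, s i) x = ∑ i ∈ A, s i x := by
  have := congrFun (map_sum (ContMDiffSection.coeAddHom I F ∞ V) s A) x
  rwa [Finset.sum_apply] at this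

theorem fun_sum_apply {ι : Type*} (A : Finset ι) (f : ι → C^∞⟮I, M; ℝ⟯) (x : M) :
    (∑ i ∈ A, f i) x = ∑ i ∈ A, f i x := by
  have := congrFun (map_sum (ContMDiffMap.coeFnAddMonoidHom (I := I) (N := M) (I' := 𝓘(ℝ, ℝ))
    (n := ∞) (G := ℝ)) f A) x
  rwa [Finset.sum_apply] at this

/-- The duality pairing `≺α, s≻` of a section of `V*` with a section of `V`. -/
def pair (α : DualSec I F V) (s : Sec I F V) : C^∞⟮I, M; ℝ⟯ :=
  ⟨fun x => α x (s x), by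
    have h : ContMDiff I (I.prod 𝓘(ℝ, ℝ)) ∞
        (fun m ↦ TotalSpace.mk' ℝ (E := Bundle.Trivial M ℝ) m (α m (s m))) :=
      ContMDiff.clm_bundle_apply (F₁ := F) (F₂ := ℝ) (E₁ := V) (E₂ := Bundle.Trivial M ℝ)
        α.contMDiff s.contMDiff
    intro x
    have := h x
    simp only [contMDiffAt_totalSpace] at this
    exact this.2⟩

@[simp]
theorem pair_apply (α : DualSec I F V) (s : Sec I F V) (x : M) : pair α s x = α x (s x) := rfl

/-- The section `φ(s)` of `W`, for a bundle homomorphism `φ : V → W` and a section `s` of `V`. -/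
def BundleHom.app (φ : BundleHom I F V F' W) (s : Sec I F V) : Sec I F' W :=
  ⟨fun x => φ x (s x), φ.contMDiff.clm_bundle_apply s.contMDiff⟩

@[simp]
theorem BundleHom.app_apply (φ : BundleHom I F V F' W) (s : Sec I F V) (x : M) :
    φ.app s x = φ x (s x) := rfl

/-- The composition of two bundle homomorphisms. -/
def BundleHom.comp {F'' : Type*} [NormedAddCommGroup F''] [NormedSpace ℝ F'']
    {U : M → Type*} [TopologicalSpace (TotalSpace F'' U)] [∀ x, AddCommGroup (U x)]
    [∀ x, Module ℝ (U x)] [∀ x, TopologicalSpace (U x)] [∀ x, IsTopologicalAddGroup (U x)]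
    [∀ x, ContinuousSMul ℝ (U x)] [FiberBundle F'' U] [VectorBundle ℝ F'' U]
    (ψ : BundleHom I F' W F'' U) (φ : BundleHom I F V F' W) : BundleHom I F V F'' U :=
  ⟨fun x => (ψ x).comp (φ x), by
    intro x₀
    have h₁ := (contMDiffAt_hom_bundle _).1 (ψ.contMDiff x₀)
    have h₂ := (contMDiffAt_hom_bundle _).1 (φ.contMDiff x₀)
    refine (contMDiffAt_hom_bundle _).2 ⟨contMDiffAt_id, ?_⟩
    refine (h₁.2.clm_comp h₂.2).congr_of_eventuallyEq ?_
    filter_upwards [(trivializationAt F' W x₀).open_baseSet.mem_nhds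
      (FiberBundle.mem_baseSet_trivializationAt F' W x₀)] with x hx
    ext v
    simp [ContinuousLinearMap.inCoordinates, hx]⟩

/-- The rank one bundle homomorphism `s ↦ ≺α, s≻ w`. -/
def rankOne (α : DualSec I F V) (w : Sec I F' W) : BundleHom I F V F' W :=
  ⟨fun x => (α x).smulRight (w x), by
    intro x₀
    have h₁ := (contMDiffAt_hom_bundle (F₁ := F) (E₁ := V) (F₂ := ℝ)
      (E₂ := Bundle.Trivial M ℝ) _).1 (α.contMDiff x₀)
    have h₂ := (contMDiffAt_section x₀).1 (w.contMDiff x₀)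
    refine (contMDiffAt_hom_bundle _).2 ⟨contMDiffAt_id, ?_⟩
    have h₃ := ((ContinuousLinearMap.smulRightL ℝ F F').contMDiff.contMDiffAt.comp x₀ h₁.2).clm_apply h₂
    refine h₃.congr_of_eventuallyEq ?_
    filter_upwards [(trivializationAt F' W x₀).open_baseSet.mem_nhds
      (FiberBundle.mem_baseSet_trivializationAt F' W x₀)] with x hx
    ext v
    simp [ContinuousLinearMap.inCoordinates, Trivialization.coe_linearMapAt_of_mem, hx]⟩

@[simp]
theorem rankOne_apply (α : DualSec I F V) (w : Sec I F' W) (x : M) (v : V x) :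
    rankOne α w x v = α x v • w x := rfl

variable [FiniteDimensional ℝ E] [IsManifold I ∞ M] [T2Space M]

/-- A smooth local section agrees near a given point with a global one. -/
theorem exists_global {s : Π x, V x} {u : Set M} (hu : IsOpen u)
    (hs : ContMDiffOn I (I.prod 𝓘(ℝ, F)) ∞ (fun x => TotalSpace.mk' F x (s x)) u)
    {x₀ : M} (hx : x₀ ∈ u) : ∃ t : Sec I F V, ∀ᶠ x in 𝓝 x₀, t x = s x := by
  obtain ⟨f, -, hf⟩ := (SmoothBumpFunction.nhds_basis_tsupport (I := I) x₀).mem_iff.1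
    (hu.mem_nhds hx)
  refine ⟨⟨_, ContMDiffOn.smul_section_of_tsupport f.contMDiff.contMDiffOn hu hf hs⟩, ?_⟩
  filter_upwards [f.eventuallyEq_one] with x hx
  simp [hx]

/-- A pointwise condition that determines an element of each fibre and is locally solved by smooth
sections is solved by a smooth global section. -/
theorem exists_glue (P : ∀ x, V x → Prop) (huniq : ∀ x v w, P x v → P x w → v = w)
    (hloc : ∀ x₀, ∃ s : Sec I F V, ∀ᶠ x in 𝓝 x₀, P x (s x)) : ∃ s : Sec I F V, ∀ x, P x (s x) := by
  choose s hs using hloc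
  refine ⟨⟨fun x => s x x, fun x₀ => ?_⟩, fun x => (hs x).self_of_nhds⟩
  refine ((s x₀).contMDiff x₀).congr_of_eventuallyEq ?_
  filter_upwards [hs x₀] with x hx
  rw [huniq x _ _ (hs x).self_of_nhds hx]

/-- Sections that agree near `x₀` agree after multiplication by a function equal to `1` at `x₀`. -/
theorem exists_cutoff {s t : Sec I F V} {x₀ : M} (h : ∀ᶠ x in 𝓝 x₀, s x = t x) :
    ∃ g : C^∞⟮I, M; ℝ⟯, g x₀ = 1 ∧ g • s = g • t := by
  obtain ⟨f, -, hf⟩ := (SmoothBumpFunction.nhds_basis_tsupport (I := I) x₀).mem_iff.1 h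
  refine ⟨⟨f, f.contMDiff⟩, f.eq_one, ?_⟩
  ext x
  by_cases hx : x ∈ tsupport f
  · change f x • s x = f x • t x
    rw [show s x = t x from hf hx]
  · change f x • s x = f x • t x
    simp [image_eq_zero_of_notMem_tsupport hx]

/-- `C^∞(M)`-linear maps between spaces of sections are local. -/
theorem linear_local (φ : Sec I F V →ₗ[C^∞⟮I, M; ℝ⟯] Sec I F' W) {s t : Sec I F V} {x₀ : M}
    (h : ∀ᶠ x in 𝓝 x₀, s x = t x) : φ s x₀ = φ t x₀ := by
  obtain ⟨g, hg, hgs⟩ := exists_cutoff h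
  simpa [hg] using congrArg (fun s => φ s x₀) hgs

/-- `C^∞(M)`-linear forms on the space of sections are local. -/
theorem form_local (φ : Sec I F V →ₗ[C^∞⟮I, M; ℝ⟯] C^∞⟮I, M; ℝ⟯) {s t : Sec I F V} {x₀ : M}
    (h : ∀ᶠ x in 𝓝 x₀, s x = t x) : φ s x₀ = φ t x₀ := by
  obtain ⟨g, hg, hgs⟩ := exists_cutoff h
  simpa [hg] using congrArg (fun s => φ s x₀) hgs

variable [FiniteDimensional ℝ F] [ContMDiffVectorBundle ∞ F V I]

variable (I F V) in
/-- Near every point there are a local frame of `V` and its dual frame, made of global sections. -/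
theorem exists_frame (x₀ : M) : ∃ (e : Fin (Module.finrank ℝ F) → Sec I F V)
    (ε : Fin (Module.finrank ℝ F) → DualSec I F V),
    ∀ᶠ x in 𝓝 x₀, ∀ v : V x, v = ∑ i, ε i x v • e i x := by
  let t := trivializationAt F V x₀
  let b := Module.finBasis ℝ F
  have ht := t.open_baseSet.mem_nhds (FiberBundle.mem_baseSet_trivializationAt F V x₀)
  have h₁ : ∀ i, ∃ s : Sec I F V, ∀ᶠ x in 𝓝 x₀, s x = t.symmL ℝ x (b i) := fun i => by
    obtain ⟨s, hs⟩ := exists_global t.open_baseSet (t.contMDiffOn_localFrame_baseSet (I := I) ∞ b i)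
      (FiberBundle.mem_baseSet_trivializationAt F V x₀)
    refine ⟨s, ?_⟩
    filter_upwards [hs, ht] with x hx hx'
    rw [hx, t.localFrame_apply_of_mem_baseSet _ hx']
    simp [Trivialization.basisAt, Trivialization.symmL_apply, hx']
  have h₂ : ∀ i, ∃ s : DualSec I F V, ∀ᶠ x in 𝓝 x₀,
      s x = (LinearMap.toContinuousLinearMap (b.coord i)).comp (t.continuousLinearMapAt ℝ x) := by
    intro i
    have hb : (trivializationAt (F →L[ℝ] ℝ) (Dual V) x₀).baseSet = t.baseSet := by
      have := hom_trivializationAt_baseSet (σ := RingHom.id ℝ) (F₁ := F) (E₁ := V) (F₂ := ℝ)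
        (E₂ := Bundle.Trivial M ℝ) x₀
      exact this.trans (Set.inter_univ _)
    refine exists_global (F := F →L[ℝ] ℝ) (V := Dual V) t.open_baseSet ?_
      (FiberBundle.mem_baseSet_trivializationAt F V x₀)
    rw [← hb, Trivialization.contMDiffOn_section_baseSet_iff]
    refine (contMDiffOn_const (c := LinearMap.toContinuousLinearMap (b.coord i))).congr ?_
    intro x hx
    rw [hb] at hx
    have := hom_trivializationAt_apply (σ := RingHom.id ℝ) (F₁ := F) (E₁ := V) (F₂ := ℝ)
      (E₂ := Bundle.Trivial M ℝ) x₀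
      ⟨x, (LinearMap.toContinuousLinearMap (b.coord i)).comp (t.continuousLinearMapAt ℝ x)⟩
    refine (congrArg Prod.snd this).trans ?_
    ext v
    simp [ContinuousLinearMap.inCoordinates, t, hx]
  choose e he using h₁
  choose ε hε using h₂
  refine ⟨e, ε, ?_⟩
  filter_upwards [Filter.eventually_all.2 he, Filter.eventually_all.2 hε, ht] with x h h' hx v
  simp only [h, h', ← map_smul, ← map_sum]
  have := b.sum_repr (t.continuousLinearMapAt ℝ x v)
  simp only [ContinuousLinearMap.comp_apply, LinearMap.coe_toContinuousLinearMap',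
    Module.Basis.coord_apply, this]
  rw [Trivialization.symmL_continuousLinearMapAt _ hx]

variable (I F) in
/-- Every vector in a fibre is the value of a global section. -/
theorem exists_eq (x : M) (v : V x) : ∃ s : Sec I F V, s x = v := by
  obtain ⟨e, ε, h⟩ := exists_frame I F V x
  refine ⟨∑ i, (ε i x v) • e i, ?_⟩
  rw [sec_sum_apply]
  exact (h.self_of_nhds v).symm

variable (I F) in
/-- Covectors separate the points of a fibre. -/
theorem eq_of_covector_eq (x : M) (v w : V x) (h : ∀ α : DualSec I F V, α x v = α x w) :
    v = w := by
  obtain ⟨e, ε, h'⟩ := exists_frame I F V x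
  rw [h'.self_of_nhds v, h'.self_of_nhds w]
  simp only [h]

/-- A `C^∞(M)`-linear form on `Γ(V)` is the pairing with a section of `V*`. -/
theorem exists_dualSection (φ : Sec I F V →ₗ[C^∞⟮I, M; ℝ⟯] C^∞⟮I, M; ℝ⟯) :
    ∃ α : DualSec I F V, ∀ s, pair α s = φ s := by
  obtain ⟨α, hα⟩ := exists_glue (I := I) (F := F →L[ℝ] ℝ) (V := Dual V)
    (fun x α => ∀ s : Sec I F V, α (s x) = φ s x) (fun x α β hα hβ => by
      ext v
      obtain ⟨s, rfl⟩ := exists_eq I F x v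
      rw [hα, hβ]) (fun x₀ => by
      obtain ⟨e, ε, h⟩ := exists_frame I F V x₀
      refine ⟨∑ i, φ (e i) • ε i, ?_⟩
      filter_upwards [h.eventually_nhds] with x hx s
      have h₁ : φ s x = φ (∑ i, pair (ε i) s • e i) x := form_local φ (by
        filter_upwards [hx] with y hy
        rw [sec_sum_apply]
        exact hy (s y))
      rw [h₁, sec_sum_apply, map_sum, fun_sum_apply, _root_.sum_apply]
      refine Finset.sum_congr rfl fun i _ => ?_
      simp [mul_comm])
  exact ⟨α, fun s => by ext x; exact hα x s⟩

/-- A `C^∞(M)`-linear form on `Γ(V*)` is the pairing with a section of `V`. -/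
theorem exists_predualSection (φ : DualSec I F V →ₗ[C^∞⟮I, M; ℝ⟯] C^∞⟮I, M; ℝ⟯) :
    ∃ s : Sec I F V, ∀ α, pair α s = φ α := by
  obtain ⟨s, hs⟩ := exists_glue (I := I) (F := F) (V := V)
    (fun x v => ∀ α : DualSec I F V, α x v = φ α x) (fun x v w hv hw =>
      eq_of_covector_eq I F x v w fun α => by rw [hv, hw]) (fun x₀ => by
      obtain ⟨e, ε, h⟩ := exists_frame I F V x₀
      refine ⟨∑ i, φ (ε i) • e i, ?_⟩
      filter_upwards [h.eventually_nhds] with x hx α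
      have h₁ : φ α x = φ (∑ i, pair α (e i) • ε i) x := form_local φ (by
        filter_upwards [hx] with y hy
        ext v
        rw [sec_sum_apply, _root_.sum_apply]
        conv_lhs => rw [hy v]
        simp [mul_comm])
      rw [h₁, sec_sum_apply, map_sum, map_sum, fun_sum_apply]
      refine Finset.sum_congr rfl fun i _ => ?_
      simp [mul_comm])
  exact ⟨s, fun α => by ext x; exact hs x α⟩

/-- A `C^∞(M)`-linear map `Γ(V) → Γ(W)` is induced by a bundle homomorphism. -/
theorem exists_bundleHom (φ : Sec I F V →ₗ[C^∞⟮I, M; ℝ⟯] Sec I F' W) :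
    ∃ L : BundleHom I F V F' W, ∀ s, L.app s = φ s := by
  obtain ⟨L, hL⟩ := exists_glue (I := I) (F := F →L[ℝ] F') (V := fun x => V x →L[ℝ] W x)
    (fun x L => ∀ s : Sec I F V, L (s x) = φ s x) (fun x α β hα hβ => by
      ext v
      obtain ⟨s, rfl⟩ := exists_eq I F x v
      rw [hα, hβ]) (fun x₀ => by
      obtain ⟨e, ε, h⟩ := exists_frame I F V x₀
      refine ⟨∑ i, rankOne (ε i) (φ (e i)), ?_⟩
      filter_upwards [h.eventually_nhds] with x hx s
      have h₁ : φ s x = φ (∑ i, pair (ε i) s • e i) x := linear_local φ (by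
        filter_upwards [hx] with y hy
        rw [sec_sum_apply]
        exact hy (s y))
      rw [h₁, sec_sum_apply, map_sum, sec_sum_apply, _root_.sum_apply]
      refine Finset.sum_congr rfl fun i _ => ?_
      simp)
  exact ⟨L, fun s => by ext x; exact hL x s⟩

/-- The section `α` of `V*` with `≺α, s≻ = φ(s)` for all sections `s` of `V`. -/
def dualSection (φ : Sec I F V →ₗ[C^∞⟮I, M; ℝ⟯] C^∞⟮I, M; ℝ⟯) : DualSec I F V :=
  (exists_dualSection φ).choose

@[simp]
theorem pair_dualSection (φ : Sec I F V →ₗ[C^∞⟮I, M; ℝ⟯] C^∞⟮I, M; ℝ⟯) (s : Sec I F V) :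
    pair (dualSection φ) s = φ s := (exists_dualSection φ).choose_spec s

/-- The section `s` of `V` with `≺α, s≻ = φ(α)` for all sections `α` of `V*`. -/
def predualSection (φ : DualSec I F V →ₗ[C^∞⟮I, M; ℝ⟯] C^∞⟮I, M; ℝ⟯) : Sec I F V :=
  (exists_predualSection φ).choose

@[simp]
theorem pair_predualSection (φ : DualSec I F V →ₗ[C^∞⟮I, M; ℝ⟯] C^∞⟮I, M; ℝ⟯)
    (α : DualSec I F V) : pair α (predualSection φ) = φ α := (exists_predualSection φ).choose_spec α

/-- The bundle homomorphism that induces a given `C^∞(M)`-linear map on sections. -/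
def bundleHom (φ : Sec I F V →ₗ[C^∞⟮I, M; ℝ⟯] Sec I F' W) : BundleHom I F V F' W :=
  (exists_bundleHom φ).choose

@[simp]
theorem app_bundleHom (φ : Sec I F V →ₗ[C^∞⟮I, M; ℝ⟯] Sec I F' W) (s : Sec I F V) :
    (bundleHom φ).app s = φ s := (exists_bundleHom φ).choose_spec s

theorem dual_ext {α β : DualSec I F V} (h : ∀ s, pair α s = pair β s) : α = β := by
  ext x v
  obtain ⟨s, rfl⟩ := exists_eq I F x v
  exact congrArg (fun f => f x) (h s)

theorem sec_ext {s t : Sec I F V} (h : ∀ α : DualSec I F V, pair α s = pair α t) : s = t := by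
  ext x
  exact eq_of_covector_eq I F x _ _ fun α => congrArg (fun f => f x) (h α)

theorem pair_add_left (α β : DualSec I F V) (s : Sec I F V) :
    pair (α + β) s = pair α s + pair β s := by ext x; simp

theorem pair_add_right (α : DualSec I F V) (s t : Sec I F V) :
    pair α (s + t) = pair α s + pair α t := by ext x; simp

theorem pair_sub_right (α : DualSec I F V) (s t : Sec I F V) :
    pair α (s - t) = pair α s - pair α t := by ext x; simp

theorem pair_smul_left (c : ℝ) (α : DualSec I F V) (s : Sec I F V) :
    pair (c • α) s = c • pair α s := by ext x; simp

theorem pair_smul_right (c : ℝ) (α : DualSec I F V) (s : Sec I F V) :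
    pair α (c • s) = c • pair α s := by ext x; simp

theorem pair_fun_smul_left (f : C^∞⟮I, M; ℝ⟯) (α : DualSec I F V) (s : Sec I F V) :
    pair (f • α) s = f * pair α s := by ext x; simp

theorem pair_fun_smul_right (f : C^∞⟮I, M; ℝ⟯) (α : DualSec I F V) (s : Sec I F V) :
    pair α (f • s) = f * pair α s := by ext x; simp

/-! ### Anchors and right-anchored products -/

variable (I F V) in
/-- An anchor on `V`: a smooth vector bundle homomorphism `V → TM`. -/
abbrev Anchor := BundleHom I F V E (TangentSpace I : M → Type _)

/-- The derivative `Z.f` of the smooth function `f` along the smooth vector field `Z`. -/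
def lieDeriv (Z : Sec I E (TangentSpace I : M → Type _)) (f : C^∞⟮I, M; ℝ⟯) : C^∞⟮I, M; ℝ⟯ :=
  ⟨fun x => mvfderiv I f x (Z x), by
    have h₁ : ContMDiff I.tangent 𝓘(ℝ, ℝ).tangent ∞ (tangentMap I 𝓘(ℝ, ℝ) f) :=
      f.contMDiff.contMDiff_tangentMap (by simp)
    exact (contMDiff_snd_tangentBundle_modelSpace ℝ 𝓘(ℝ, ℝ)).comp (h₁.comp Z.contMDiff)⟩

theorem mdiffAt (f : C^∞⟮I, M; ℝ⟯) (x : M) : MDifferentiableAt I 𝓘(ℝ, ℝ) f x :=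
  f.contMDiff.mdifferentiable (by simp) x

/-- `ρ(a).f` -/
def Anchor.deriv (ρ : Anchor I F V) (a : Sec I F V) (f : C^∞⟮I, M; ℝ⟯) : C^∞⟮I, M; ℝ⟯ :=
  lieDeriv (ρ.app a) f

namespace Anchor

variable (ρ : Anchor I F V)

theorem deriv_apply (a : Sec I F V) (f : C^∞⟮I, M; ℝ⟯) (x : M) :
    ρ.deriv a f x = mvfderiv I f x (ρ x (a x)) := rfl

theorem deriv_add (a : Sec I F V) (f g : C^∞⟮I, M; ℝ⟯) :
    ρ.deriv a (f + g) = ρ.deriv a f + ρ.deriv a g := by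
  ext x
  simp [deriv_apply, mvfderiv_add (mdiffAt f x) (mdiffAt g x)]

theorem deriv_mul (a : Sec I F V) (f g : C^∞⟮I, M; ℝ⟯) :
    ρ.deriv a (f * g) = f * ρ.deriv a g + ρ.deriv a f * g := by
  ext x
  simp [deriv_apply, mvfderiv_mul (mdiffAt f x) (mdiffAt g x), mul_comm]

theorem deriv_smul (c : ℝ) (a : Sec I F V) (f : C^∞⟮I, M; ℝ⟯) :
    ρ.deriv a (c • f) = c • ρ.deriv a f := by
  ext x
  have h := mvfderiv_mul (mdiffAt (ContMDiffMap.const c) x) (mdiffAt f x)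
  have h' : ⇑(c • f) = ⇑(ContMDiffMap.const c : C^∞⟮I, M; ℝ⟯) * ⇑f := rfl
  have h₀ : mvfderiv I (⇑(ContMDiffMap.const c : C^∞⟮I, M; ℝ⟯)) x = 0 := mvfderiv_const c
  rw [deriv_apply, h', h, h₀]
  simp [deriv_apply, ContMDiffMap.const]

theorem deriv_add_left (a b : Sec I F V) (f : C^∞⟮I, M; ℝ⟯) :
    ρ.deriv (a + b) f = ρ.deriv a f + ρ.deriv b f := by
  ext x
  simp [deriv_apply]

theorem deriv_smul_left (c : ℝ) (a : Sec I F V) (f : C^∞⟮I, M; ℝ⟯) :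
    ρ.deriv (c • a) f = c • ρ.deriv a f := by
  ext x
  simp [deriv_apply]

theorem deriv_fun_smul_left (g : C^∞⟮I, M; ℝ⟯) (a : Sec I F V) (f : C^∞⟮I, M; ℝ⟯) :
    ρ.deriv (g • a) f = g * ρ.deriv a f := by
  ext x
  simp [deriv_apply]

end Anchor

/-- A right-anchored product on the anchored bundle `(V, M, ρ)`. -/
structure RightAnchoredProduct (ρ : Anchor I F V) where
  /-- The product `T_a b` -/
  prod : Sec I F V →ₗ[ℝ] Sec I F V →ₗ[ℝ] Sec I F V
  fun_smul_left : ∀ (f : C^∞⟮I, M; ℝ⟯) (a b : Sec I F V), prod (f • a) b = f • prod a b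
  fun_smul_right : ∀ (f : C^∞⟮I, M; ℝ⟯) (a b : Sec I F V),
    prod a (f • b) = f • prod a b + ρ.deriv a f • b

/-- The commutator bracket `[a, b] = D_a b - D_b a` of a product. -/
def commBracket {G : Type*} [AddCommGroup G] (D : G → G → G) (a b : G) : G := D a b - D b a

/-- The curvature `R(a, b) c = D_a D_b c - D_b D_a c - D_[a, b] c` of a product, where
`[a, b] = D_a b - D_b a`. -/
def curvature {G : Type*} [AddCommGroup G] (D : G → G → G) (a b c : G) : G :=
  D a (D b c) - D b (D a c) - D (commBracket D a b) c

namespace RightAnchoredProduct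

instance {ρ : Anchor I F V} : CoeFun (RightAnchoredProduct ρ)
    (fun _ => Sec I F V → Sec I F V → Sec I F V) := ⟨fun S a b => S.prod a b⟩

/-- `(V, M, ρ, S)` is a left symmetric algebroid: the curvature of `S` vanishes identically. -/
def IsLeftSymmetric {ρ : Anchor I F V} (S : RightAnchoredProduct ρ) : Prop :=
  ∀ a b c, curvature S a b c = 0

/-- The section `S*_X α` of `V*`, characterized by `≺S*_X α, Y≻ = ρ(X).≺α, Y≻ - ≺α, S_X Y≻`. -/
def dual {ρ : Anchor I F V} (S : RightAnchoredProduct ρ) (X : Sec I F V) (α : DualSec I F V) :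
    DualSec I F V :=
  dualSection
    { toFun := fun Y => ρ.deriv X (pair α Y) - pair α (S X Y)
      map_add' := fun Y Z => by
        simp only [map_add, pair_add_right, Anchor.deriv_add]
        ring
      map_smul' := fun f Y => by
        simp only [S.fun_smul_right, pair_add_right, pair_fun_smul_right, Anchor.deriv_mul,
          RingHom.id_apply, smul_eq_mul]
        ring }

theorem pair_dual {ρ : Anchor I F V} (S : RightAnchoredProduct ρ) (X Y : Sec I F V)
    (α : DualSec I F V) :
    pair (S.dual X α) Y = ρ.deriv X (pair α Y) - pair α (S X Y) :=
  pair_dualSection _ _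

/-- For a product `T` on `V*`, the section `T*_α X` of `V = V**`, characterized by
`≺β, T*_α X≻ = ρ₁(α).≺β, X≻ - ≺T_α β, X≻`. -/
def predual {ρ₁ : Anchor I (F →L[ℝ] ℝ) (Dual V)} (T : RightAnchoredProduct ρ₁)
    (α : DualSec I F V) (X : Sec I F V) : Sec I F V :=
  predualSection
    { toFun := fun β => ρ₁.deriv α (pair β X) - pair (T α β) X
      map_add' := fun β γ => by
        simp only [map_add, pair_add_left, Anchor.deriv_add]
        ring
      map_smul' := fun f β => by
        simp only [T.fun_smul_right, pair_add_left, pair_fun_smul_left, Anchor.deriv_mul,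
          RingHom.id_apply, smul_eq_mul]
        ring }

theorem pair_predual {ρ₁ : Anchor I (F →L[ℝ] ℝ) (Dual V)} (T : RightAnchoredProduct ρ₁)
    (α β : DualSec I F V) (X : Sec I F V) :
    pair β (T.predual α X) = ρ₁.deriv α (pair β X) - pair (T α β) X :=
  pair_predualSection _ _

theorem dual_add_left {ρ : Anchor I F V} (S : RightAnchoredProduct ρ) (X Y : Sec I F V)
    (α : DualSec I F V) : S.dual (X + Y) α = S.dual X α + S.dual Y α := dual_ext fun s => by
  simp only [pair_dual, pair_add_left, map_add, LinearMap.add_apply, pair_add_right,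
    Anchor.deriv_add_left]
  ring

theorem dual_add_right {ρ : Anchor I F V} (S : RightAnchoredProduct ρ) (X : Sec I F V)
    (α β : DualSec I F V) : S.dual X (α + β) = S.dual X α + S.dual X β := dual_ext fun s => by
  simp only [pair_dual, pair_add_left, Anchor.deriv_add]
  ring

theorem dual_smul_left {ρ : Anchor I F V} (S : RightAnchoredProduct ρ) (c : ℝ) (X : Sec I F V)
    (α : DualSec I F V) : S.dual (c • X) α = c • S.dual X α := dual_ext fun s => by
  simp only [pair_dual, pair_smul_left, map_smul, LinearMap.smul_apply, pair_smul_right,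
    Anchor.deriv_smul_left, smul_sub]

theorem dual_smul_right {ρ : Anchor I F V} (S : RightAnchoredProduct ρ) (c : ℝ) (X : Sec I F V)
    (α : DualSec I F V) : S.dual X (c • α) = c • S.dual X α := dual_ext fun s => by
  simp only [pair_dual, pair_smul_left, Anchor.deriv_smul, smul_sub]

theorem dual_fun_smul_left {ρ : Anchor I F V} (S : RightAnchoredProduct ρ) (f : C^∞⟮I, M; ℝ⟯)
    (X : Sec I F V) (α : DualSec I F V) : S.dual (f • X) α = f • S.dual X α := dual_ext fun s => by
  simp only [pair_dual, pair_fun_smul_left, S.fun_smul_left, pair_fun_smul_right,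
    Anchor.deriv_fun_smul_left]
  ring

theorem dual_fun_smul_right {ρ : Anchor I F V} (S : RightAnchoredProduct ρ) (f : C^∞⟮I, M; ℝ⟯)
    (X : Sec I F V) (α : DualSec I F V) :
    S.dual X (f • α) = f • S.dual X α + ρ.deriv X f • α := dual_ext fun s => by
  simp only [pair_dual, pair_add_left, pair_fun_smul_left, Anchor.deriv_mul]
  ring

end RightAnchoredProduct

/-! ### Compatibility -/

section Compatible

variable {ρ₀ : Anchor I F V} {ρ₁ : Anchor I (F →L[ℝ] ℝ) (Dual V)}

/-- The product `∇_{X + α} (Y + β) = S_X Y + T*_α Y + S*_X β + T_α β` on the sections of the phase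
space `Φ(V) = V ⊕ V*`, a section `X + α` being written as the pair `(X, α)`. -/
def phaseProduct (S : RightAnchoredProduct ρ₀) (T : RightAnchoredProduct ρ₁)
    (u v : Sec I F V × DualSec I F V) : Sec I F V × DualSec I F V :=
  (S u.1 v.1 + T.predual u.2 v.1, S.dual u.1 v.2 + T u.2 v.2)

/-- The products `S` on `V` and `T` on `V*` are compatible (Lie-extendible):
`R(X, α) Y = R(Y, α) X` and `R(α, X) β = R(β, X) α`, with `R` the curvature of the product on the
phase space. -/
def IsCompatible (S : RightAnchoredProduct ρ₀) (T : RightAnchoredProduct ρ₁) : Prop :=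
  (∀ (X Y : Sec I F V) (α : DualSec I F V),
    curvature (phaseProduct S T) (X, 0) (0, α) (Y, 0) =
      curvature (phaseProduct S T) (Y, 0) (0, α) (X, 0)) ∧
  ∀ (α β : DualSec I F V) (X : Sec I F V),
    curvature (phaseProduct S T) (0, α) (X, 0) (0, β) =
      curvature (phaseProduct S T) (0, β) (X, 0) (0, α)

end Compatible

/-! ### The structures induced by a two-tensor -/

/-- The smooth function `r(α, β)`. -/
def BiTensor.eval (r : BiTensor I F V) (α β : DualSec I F V) : C^∞⟮I, M; ℝ⟯ :=
  pair (V := Dual V) (F := F →L[ℝ] ℝ) (BundleHom.app (W := Dual (Dual V)) r α) β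

namespace BiTensor

variable (r : BiTensor I F V)

@[simp]
theorem eval_apply (α β : DualSec I F V) (x : M) : r.eval α β x = r x (α x) (β x) := rfl

theorem eval_add_left (α α' β : DualSec I F V) :
    r.eval (α + α') β = r.eval α β + r.eval α' β := by ext x; simp

theorem eval_add_right (α β β' : DualSec I F V) :
    r.eval α (β + β') = r.eval α β + r.eval α β' := by ext x; simp

theorem eval_smul_left (c : ℝ) (α β : DualSec I F V) :
    r.eval (c • α) β = c • r.eval α β := by ext x; simp

theorem eval_smul_right (c : ℝ) (α β : DualSec I F V) :
    r.eval α (c • β) = c • r.eval α β := by ext x; simp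

theorem eval_fun_smul_left (f : C^∞⟮I, M; ℝ⟯) (α β : DualSec I F V) :
    r.eval (f • α) β = f * r.eval α β := by ext x; simp

theorem eval_fun_smul_right (f : C^∞⟮I, M; ℝ⟯) (α β : DualSec I F V) :
    r.eval α (f • β) = f * r.eval α β := by ext x; simp

/-- The section `r_#(α)` of `V`, characterized by `≺β, r_#(α)≻ = r(α, β)`. -/
def sharpSec (α : DualSec I F V) : Sec I F V :=
  predualSection
    { toFun := fun β => r.eval α β
      map_add' := fun β γ => r.eval_add_right α β γ
      map_smul' := fun f β => r.eval_fun_smul_right f α β }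

theorem pair_sharpSec (α β : DualSec I F V) : pair β (r.sharpSec α) = r.eval α β :=
  pair_predualSection _ _

/-- The bundle homomorphism `r_# : V* → V`. -/
def sharp : BundleHom I (F →L[ℝ] ℝ) (Dual V) F V :=
  bundleHom
    { toFun := fun α => r.sharpSec α
      map_add' := fun α β => sec_ext fun γ => by
        simp only [pair_sharpSec, pair_add_right, eval_add_left]
      map_smul' := fun f α => sec_ext fun γ => by
        simp only [pair_sharpSec, pair_fun_smul_right, eval_fun_smul_left, RingHom.id_apply] }

theorem pair_sharp (α β : DualSec I F V) : pair β (r.sharp.app α) = r.eval α β := by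
  rw [sharp, app_bundleHom]
  exact r.pair_sharpSec α β

/-- The skew-symmetric part `𝔞` of `r`, as a bilinear map on the sections of `V*`. -/
def skewPart (α β : DualSec I F V) : C^∞⟮I, M; ℝ⟯ := (1 / 2 : ℝ) • (r.eval α β - r.eval β α)

/-- The anchor `ρ_r = ρ ∘ r_#` on `V*`. -/
def anchor (ρ : Anchor I F V) : Anchor I (F →L[ℝ] ℝ) (Dual V) := BundleHom.comp ρ r.sharp

theorem anchor_deriv (ρ : Anchor I F V) (α : DualSec I F V) (f : C^∞⟮I, M; ℝ⟯) :
    (r.anchor ρ).deriv α f = ρ.deriv (r.sharp.app α) f := rfl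

end BiTensor

/-- `S_X B(α, β) = ρ(X).B(α, β) - B(S*_X α, β) - B(α, S*_X β)` for a bilinear map `B` on the
sections of `V*`. -/
def tensorDeriv {ρ : Anchor I F V} (S : RightAnchoredProduct ρ) (X : Sec I F V)
    (B : DualSec I F V → DualSec I F V → C^∞⟮I, M; ℝ⟯) (α β : DualSec I F V) : C^∞⟮I, M; ℝ⟯ :=
  ρ.deriv X (B α β) - B (S.dual X α) β - B α (S.dual X β)

/-- `S²_{X, Y} B = S_X S_Y B - S_{S_X Y} B`. -/
def tensorDeriv₂ {ρ : Anchor I F V} (S : RightAnchoredProduct ρ) (X Y : Sec I F V)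
    (B : DualSec I F V → DualSec I F V → C^∞⟮I, M; ℝ⟯) (α β : DualSec I F V) : C^∞⟮I, M; ℝ⟯ :=
  tensorDeriv S X (tensorDeriv S Y B) α β - tensorDeriv S (S X Y) B α β

section Induced

variable {ρ : Anchor I F V} (S : RightAnchoredProduct ρ) (r : BiTensor I F V)

/-- The section `T_α β` of `V*`, characterized by
`≺T_α β, X≻ = S_X r(α, β) + ≺S*_{r_#(α)} β, X≻`. -/
def inducedSec (α β : DualSec I F V) : DualSec I F V :=
  dualSection
    { toFun := fun X => tensorDeriv S X r.eval α β + pair (S.dual (r.sharp.app α) β) X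
      map_add' := fun X Y => by
        simp only [tensorDeriv, pair_add_right, Anchor.deriv_add_left, S.dual_add_left,
          r.eval_add_left, r.eval_add_right]
        ring
      map_smul' := fun f X => by
        simp only [tensorDeriv, pair_fun_smul_right, Anchor.deriv_fun_smul_left,
          S.dual_fun_smul_left, r.eval_fun_smul_left, r.eval_fun_smul_right, RingHom.id_apply,
          smul_eq_mul]
        ring }

theorem pair_inducedSec (α β : DualSec I F V) (X : Sec I F V) :
    pair (inducedSec S r α β) X =
      tensorDeriv S X r.eval α β + pair (S.dual (r.sharp.app α) β) X :=
  pair_dualSection _ _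

theorem sharp_app_add (α β : DualSec I F V) :
    r.sharp.app (α + β) = r.sharp.app α + r.sharp.app β := by ext x; simp

theorem sharp_app_smul (c : ℝ) (α : DualSec I F V) :
    r.sharp.app (c • α) = c • r.sharp.app α := by ext x; simp

theorem sharp_app_fun_smul (f : C^∞⟮I, M; ℝ⟯) (α : DualSec I F V) :
    r.sharp.app (f • α) = f • r.sharp.app α := by ext x; simp

/-- The right-anchored product `T` induced by `r` on `(V*, M, ρ_r)`. -/
def inducedProduct : RightAnchoredProduct (r.anchor ρ) where
  prod := LinearMap.mk₂ ℝ (inducedSec S r)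
    (fun α α' β => dual_ext fun X => by
      simp only [pair_inducedSec, tensorDeriv, pair_add_left, r.eval_add_left, S.dual_add_right,
        S.dual_add_left, sharp_app_add, Anchor.deriv_add]
      ring)
    (fun c α β => dual_ext fun X => by
      simp only [pair_inducedSec, tensorDeriv, pair_smul_left, r.eval_smul_left, S.dual_smul_right,
        S.dual_smul_left, sharp_app_smul, Anchor.deriv_smul, smul_add, smul_sub])
    (fun α β β' => dual_ext fun X => by
      simp only [pair_inducedSec, tensorDeriv, pair_add_left, r.eval_add_right, S.dual_add_right,
        Anchor.deriv_add]
      ring)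
    (fun c α β => dual_ext fun X => by
      simp only [pair_inducedSec, tensorDeriv, pair_smul_left, r.eval_smul_right,
        S.dual_smul_right, Anchor.deriv_smul, smul_add, smul_sub])
  fun_smul_left f α β := dual_ext fun X => by
    simp only [LinearMap.mk₂_apply, pair_inducedSec, tensorDeriv, pair_fun_smul_left,
      r.eval_fun_smul_left, r.eval_add_left, S.dual_fun_smul_right, S.dual_fun_smul_left,
      sharp_app_fun_smul, Anchor.deriv_mul]
    ring
  fun_smul_right f α β := dual_ext fun X => by
    simp only [LinearMap.mk₂_apply, pair_inducedSec, tensorDeriv, pair_fun_smul_left,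
      pair_add_left, r.eval_fun_smul_right, r.eval_add_right, S.dual_fun_smul_right,
      Anchor.deriv_mul, r.anchor_deriv]
    ring

theorem pair_inducedProduct (α β : DualSec I F V) (X : Sec I F V) :
    pair (inducedProduct S r α β) X =
      tensorDeriv S X r.eval α β + pair (S.dual (r.sharp.app α) β) X :=
  pair_inducedSec S r α β X

/-- `Δ(r)(α, β) = r_#([α, β]_T) - [r_#(α), r_#(β)]_S`. -/
def Delta (α β : DualSec I F V) : Sec I F V :=
  r.sharp.app (commBracket (inducedProduct S r) α β) -
    commBracket S (r.sharp.app α) (r.sharp.app β)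

end Induced

end
end LSAlgebroid

open LSAlgebroid

namespace LSAlgebroid
noncomputable section

variable {E : Type*} [NormedAddCommGroup E] [NormedSpace ℝ E] [FiniteDimensional ℝ E]
  {H : Type*} [TopologicalSpace H] {I : ModelWithCorners ℝ E H}
  {M : Type*} [TopologicalSpace M] [ChartedSpace H M] [IsManifold I ∞ M] [T2Space M]
  {F : Type*} [NormedAddCommGroup F] [NormedSpace ℝ F] [FiniteDimensional ℝ F]
  {V : M → Type*} [TopologicalSpace (TotalSpace F V)] [∀ x, AddCommGroup (V x)]
  [∀ x, Module ℝ (V x)] [∀ x, TopologicalSpace (V x)] [∀ x, IsTopologicalAddGroup (V x)]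
  [∀ x, ContinuousSMul ℝ (V x)] [FiberBundle F V] [VectorBundle ℝ F V]
  [ContMDiffVectorBundle ∞ F V I]

/-- Smooth functions separate tangent vectors. -/
theorem eq_zero_of_forall_mvfderiv_eq_zero (x : M) (v : TangentSpace I x)
    (h : ∀ f : C^∞⟮I, M; ℝ⟯, mvfderiv I f x v = 0) : v = 0 := by
  have hinj := (isInvertible_mfderiv_extChartAt (I := I) (mem_extChartAt_source (I := I) x)).injective
  refine hinj ?_
  rw [map_zero]
  by_contra hne
  obtain ⟨l, hl⟩ : ∃ l : E →L[ℝ] ℝ,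
      l (mfderiv I 𝓘(ℝ, E) (extChartAt I x) x v : E) ≠ 0 := by
    by_contra! hcon
    exact hne (SeparatingDual.eq_zero_of_forall_dual_eq_zero (R := ℝ) (V := E) hcon)
  obtain ⟨b⟩ : Nonempty (SmoothBumpFunction I x) := inferInstance
  have hg : ContMDiffOn I 𝓘(ℝ, ℝ) ∞ (fun y => l (extChartAt I x y)) (chartAt H x).source :=
    l.contMDiff.comp_contMDiffOn (contMDiffOn_extChartAt)
  refine hl ?_
  have h₁ := h ⟨_, b.contMDiff_smul hg⟩
  have h₂ : (fun y => b y • l (extChartAt I x y)) =ᶠ[𝓝 x] (l ∘ extChartAt I x) := by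
    filter_upwards [b.eventuallyEq_one] with y hy
    simp [hy]
  have h₃ : mfderiv I 𝓘(ℝ, ℝ) (fun y => b y • l (extChartAt I x y)) x v = 0 := h₁
  rw [h₂.mfderiv_eq, mfderiv_comp x l.mdifferentiableAt
    (mdifferentiableAt_extChartAt (mem_chart_source H x))] at h₃
  rw [ContinuousLinearMap.mfderiv_eq] at h₃
  exact h₃

namespace Anchor

variable (ρ : Anchor I F V)

theorem deriv_zero (a : Sec I F V) : ρ.deriv a 0 = 0 := by
  simpa using ρ.deriv_smul 0 a 0

theorem deriv_neg (a : Sec I F V) (f : C^∞⟮I, M; ℝ⟯) : ρ.deriv a (-f) = -ρ.deriv a f := by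
  simpa using ρ.deriv_smul (-1) a f

theorem deriv_sub (a : Sec I F V) (f g : C^∞⟮I, M; ℝ⟯) :
    ρ.deriv a (f - g) = ρ.deriv a f - ρ.deriv a g := by
  rw [sub_eq_add_neg, deriv_add, deriv_neg, ← sub_eq_add_neg]

theorem deriv_sub_left (a b : Sec I F V) (f : C^∞⟮I, M; ℝ⟯) :
    ρ.deriv (a - b) f = ρ.deriv a f - ρ.deriv b f := by
  ext x
  simp [deriv_apply]

end Anchor

theorem pair_sub_left (α β : DualSec I F V) (s : Sec I F V) :
    pair (α - β) s = pair α s - pair β s := by ext x; simp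

theorem pair_zero_left (s : Sec I F V) : pair (0 : DualSec I F V) s = 0 := by ext x; simp

theorem pair_zero_right (α : DualSec I F V) : pair α (0 : Sec I F V) = 0 := by ext x; simp

namespace RightAnchoredProduct

variable {ρ : Anchor I F V} (S : RightAnchoredProduct ρ)

theorem zero_left (Y : Sec I F V) : S 0 Y = 0 := by
  simp

theorem zero_right (X : Sec I F V) : S X 0 = 0 := (S.prod X).map_zero

theorem neg_left (X Y : Sec I F V) : S (-X) Y = -S X Y := by
  simp

theorem curvature_fun_smul (f : C^∞⟮I, M; ℝ⟯) (a b c : Sec I F V) :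
    curvature S a b (f • c) = f • curvature S a b c +
      (ρ.deriv a (ρ.deriv b f) - ρ.deriv b (ρ.deriv a f) - ρ.deriv (commBracket S a b) f) • c := by
  simp only [curvature, S.fun_smul_right, map_add]
  module

variable {S}

/-- The anchor of a left symmetric algebroid is compatible with the brackets. -/
theorem IsLeftSymmetric.deriv_commBracket (hS : S.IsLeftSymmetric) (a b : Sec I F V)
    (f : C^∞⟮I, M; ℝ⟯) :
    ρ.deriv (commBracket S a b) f = ρ.deriv a (ρ.deriv b f) - ρ.deriv b (ρ.deriv a f) := by
  ext x
  by_cases hx : ∀ v : V x, v = 0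
  · have h : ∀ s : Sec I F V, ∀ g : C^∞⟮I, M; ℝ⟯, ρ.deriv s g x = 0 := fun s g => by
      rw [Anchor.deriv_apply, hx (s x), map_zero, map_zero]
    simp [h]
  · push Not at hx
    obtain ⟨v, hv⟩ := hx
    obtain ⟨c, rfl⟩ := exists_eq I F x v
    have h := S.curvature_fun_smul f a b c
    rw [hS, hS, smul_zero, zero_add] at h
    have h' := congrArg (fun s => s x) h
    have h'' := (smul_eq_zero.1 h'.symm).resolve_right hv
    exact (sub_eq_zero.1 h'').symm

theorem dual_sub_left (X Y : Sec I F V) (α : DualSec I F V) :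
    S.dual (X - Y) α = S.dual X α - S.dual Y α := by
  rw [eq_sub_iff_add_eq, ← dual_add_left, sub_add_cancel]

theorem dual_sub_right (X : Sec I F V) (α β : DualSec I F V) :
    S.dual X (α - β) = S.dual X α - S.dual X β := by
  rw [eq_sub_iff_add_eq, ← dual_add_right, sub_add_cancel]

theorem dual_zero_left (α : DualSec I F V) : S.dual 0 α = 0 := by
  simpa using S.dual_smul_left 0 0 α

theorem dual_zero_right (X : Sec I F V) : S.dual X 0 = 0 := by
  simpa using S.dual_smul_right 0 X 0

theorem predual_zero_left {ρ₁ : Anchor I (F →L[ℝ] ℝ) (Dual V)} (T : RightAnchoredProduct ρ₁)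
    (X : Sec I F V) : T.predual 0 X = 0 := sec_ext fun β => by
  have h : ρ₁.deriv 0 (pair β X) = 0 := by simpa using ρ₁.deriv_smul_left 0 0 (pair β X)
  rw [pair_predual, h, T.zero_left, pair_zero_left, pair_zero_right, sub_zero]

theorem predual_zero_right {ρ₁ : Anchor I (F →L[ℝ] ℝ) (Dual V)} (T : RightAnchoredProduct ρ₁)
    (α : DualSec I F V) : T.predual α 0 = 0 := sec_ext fun β => by
  rw [pair_predual, pair_zero_right, pair_zero_right, Anchor.deriv_zero, sub_zero]

theorem IsLeftSymmetric.prod_commBracket (hS : S.IsLeftSymmetric) (X Y Z : Sec I F V) :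
    S (commBracket S X Y) Z = S X (S Y Z) - S Y (S X Z) :=
  (sub_eq_zero.1 (hS X Y Z)).symm

/-- The dual of a flat product is flat. -/
theorem IsLeftSymmetric.dual_commBracket (hS : S.IsLeftSymmetric) (X Y : Sec I F V)
    (α : DualSec I F V) :
    S.dual (commBracket S X Y) α = S.dual X (S.dual Y α) - S.dual Y (S.dual X α) :=
  dual_ext fun Z => by
    simp only [pair_sub_left, pair_dual, hS.deriv_commBracket, hS.prod_commBracket,
      pair_sub_right, Anchor.deriv_sub]
    ring

end RightAnchoredProduct

namespace BiTensor

variable (r : BiTensor I F V)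

theorem eval_sub_left (α α' β : DualSec I F V) :
    r.eval (α - α') β = r.eval α β - r.eval α' β := by ext x; simp

theorem eval_sub_right (α β β' : DualSec I F V) :
    r.eval α (β - β') = r.eval α β - r.eval α β' := by ext x; simp

end BiTensor

section Induced

open RightAnchoredProduct

variable {ρ : Anchor I F V} (S : RightAnchoredProduct ρ) (r : BiTensor I F V)

theorem tensorDeriv_sub_left (X Y : Sec I F V) (α β : DualSec I F V) :
    tensorDeriv S (X - Y) r.eval α β = tensorDeriv S X r.eval α β - tensorDeriv S Y r.eval α β := by
  simp only [tensorDeriv, Anchor.deriv_sub_left, dual_sub_left, r.eval_sub_left, r.eval_sub_right]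
  ring

/-- `S_X r(α, β) = ≺β, S_X r_#(α) - r_#(S*_X α)≻`. -/
theorem tensorDeriv_eval (X : Sec I F V) (α β : DualSec I F V) :
    tensorDeriv S X r.eval α β = pair β (S X (r.sharp.app α) - r.sharp.app (S.dual X α)) := by
  rw [tensorDeriv, pair_sub_right, r.pair_sharp, ← r.pair_sharp α (S.dual X β), pair_dual,
    r.pair_sharp]
  ring

variable {S} in
theorem tensorDeriv₂_eval_comm (hS : S.IsLeftSymmetric) (X Y : Sec I F V) (α β : DualSec I F V) :
    tensorDeriv₂ S X Y r.eval α β = tensorDeriv₂ S Y X r.eval α β := by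
  have h : tensorDeriv S (commBracket S X Y) r.eval α β =
      tensorDeriv S (S X Y) r.eval α β - tensorDeriv S (S Y X) r.eval α β :=
    tensorDeriv_sub_left S r _ _ α β
  rw [tensorDeriv, hS.deriv_commBracket, hS.dual_commBracket, hS.dual_commBracket,
    r.eval_sub_left, r.eval_sub_right] at h
  simp only [tensorDeriv₂]
  rw [sub_eq_sub_iff_sub_eq_sub, ← h]
  simp only [tensorDeriv, Anchor.deriv_sub]
  ring

theorem tensorDeriv_skewPart (X : Sec I F V) (α β : DualSec I F V) :
    tensorDeriv S X r.skewPart α β =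
      (1 / 2 : ℝ) • (tensorDeriv S X r.eval α β - tensorDeriv S X r.eval β α) := by
  simp only [tensorDeriv, BiTensor.skewPart, Anchor.deriv_smul, Anchor.deriv_sub]
  module

theorem tensorDeriv₂_skewPart (X Y : Sec I F V) (α β : DualSec I F V) :
    tensorDeriv₂ S X Y r.skewPart α β =
      (1 / 2 : ℝ) • (tensorDeriv₂ S X Y r.eval α β - tensorDeriv₂ S X Y r.eval β α) := by
  have h : tensorDeriv S Y r.skewPart = fun α β =>
      (1 / 2 : ℝ) • (tensorDeriv S Y r.eval α β - tensorDeriv S Y r.eval β α) := by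
    funext α β
    exact tensorDeriv_skewPart S r Y α β
  rw [tensorDeriv₂, h, tensorDeriv_skewPart]
  simp only [tensorDeriv₂, tensorDeriv.eq_1 S X, Anchor.deriv_smul, Anchor.deriv_sub]
  module

theorem tensorDeriv₂_skewPart_eq_zero_iff (X Y : Sec I F V) (α β : DualSec I F V) :
    tensorDeriv₂ S X Y r.skewPart α β = 0 ↔
      tensorDeriv₂ S X Y r.eval α β = tensorDeriv₂ S X Y r.eval β α := by
  rw [tensorDeriv₂_skewPart, smul_eq_zero, sub_eq_zero]
  norm_num

theorem curvature_phaseProduct_fst {ρ₁ : Anchor I (F →L[ℝ] ℝ) (Dual V)}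
    (T : RightAnchoredProduct ρ₁) (X Y : Sec I F V) (α : DualSec I F V) :
    curvature (phaseProduct S T) (X, 0) (0, α) (Y, 0) =
      (S X (T.predual α Y) - T.predual α (S X Y) -
        (T.predual (S.dual X α) Y - S (T.predual α X) Y), 0) := by
  simp only [curvature, commBracket, phaseProduct, zero_left, zero_right, dual_zero_right,
    predual_zero_left, predual_zero_right, Prod.mk_sub_mk, add_zero, zero_add,
    sub_zero, zero_sub, neg_left]
  rw [neg_add_eq_sub]

theorem curvature_phaseProduct_snd {ρ₁ : Anchor I (F →L[ℝ] ℝ) (Dual V)}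
    (T : RightAnchoredProduct ρ₁) (X : Sec I F V) (α β : DualSec I F V) :
    curvature (phaseProduct S T) (0, α) (X, 0) (0, β) =
      (0, T α (S.dual X β) - S.dual X (T α β) -
        (S.dual (T.predual α X) β - T (S.dual X α) β)) := by
  simp only [curvature, commBracket, phaseProduct, zero_left, zero_right, dual_zero_left,
    dual_zero_right, predual_zero_right, Prod.mk_sub_mk, add_zero, zero_add, sub_zero, zero_sub,
    T.neg_left]
  rw [← sub_eq_add_neg]

/-- `T*_α X = r_#(S*_X α) - [X, r_#(α)]_S`. -/
theorem predual_inducedProduct (α : DualSec I F V) (X : Sec I F V) :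
    (inducedProduct S r).predual α X =
      r.sharp.app (S.dual X α) - commBracket S X (r.sharp.app α) := sec_ext fun β => by
  rw [pair_predual, pair_inducedProduct, tensorDeriv_eval, pair_dual, r.anchor_deriv, commBracket]
  simp only [pair_sub_right]
  ring

variable {S} in
/-- `≺β, R(X, α) Y≻ = - S²_{X, Y} r(α, β)`. -/
theorem pair_curvature_phaseProduct_fst (hS : S.IsLeftSymmetric) (X Y : Sec I F V)
    (α β : DualSec I F V) :
    pair β (curvature (phaseProduct S (inducedProduct S r)) (X, 0) (0, α) (Y, 0)).1 =
      -tensorDeriv₂ S X Y r.eval α β := by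
  have h := congrArg (pair β) (hS.prod_commBracket X (r.sharp.app α) Y)
  rw [curvature_phaseProduct_fst]
  simp only [commBracket, map_sub, LinearMap.sub_apply, pair_sub_right] at h
  simp only [predual_inducedProduct, tensorDeriv₂, tensorDeriv.eq_1 S X, tensorDeriv_eval,
    commBracket, pair_sub_right, map_sub, LinearMap.sub_apply, pair_dual, Anchor.deriv_sub]
  linear_combination -h

variable {S} in
/-- `≺R(α, X) β, Y≻ = - S²_{X, Y} r(α, β)`. -/
theorem pair_curvature_phaseProduct_snd (hS : S.IsLeftSymmetric) (X Y : Sec I F V)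
    (α β : DualSec I F V) :
    pair (curvature (phaseProduct S (inducedProduct S r)) (0, α) (X, 0) (0, β)).2 Y =
      -tensorDeriv₂ S X Y r.eval α β := by
  rw [curvature_phaseProduct_snd]
  simp only [predual_inducedProduct, dual_sub_left, hS.dual_commBracket, pair_sub_left,
    pair_inducedProduct, pair_dual S X, tensorDeriv₂, tensorDeriv.eq_1 S X, Anchor.deriv_add]
  ring

variable {S} in
theorem isCompatible_inducedProduct_iff (hS : S.IsLeftSymmetric) :
    IsCompatible S (inducedProduct S r) ↔
      ∀ (X Y : Sec I F V) (α β : DualSec I F V), tensorDeriv₂ S X Y r.skewPart α β = 0 := by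
  simp only [tensorDeriv₂_skewPart_eq_zero_iff]
  constructor
  · rintro ⟨-, h⟩ X Y α β
    have h' := congrArg (fun u => pair u.2 Y) (h α β X)
    simp only [pair_curvature_phaseProduct_snd r hS] at h'
    exact neg_injective h'
  · intro h
    refine ⟨fun X Y α => Prod.ext (sec_ext fun β => ?_) ?_,
      fun α β X => Prod.ext ?_ (dual_ext fun Y => ?_)⟩
    · rw [pair_curvature_phaseProduct_fst r hS, pair_curvature_phaseProduct_fst r hS,
        tensorDeriv₂_eval_comm r hS]
    · rw [curvature_phaseProduct_fst, curvature_phaseProduct_fst]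
    · rw [curvature_phaseProduct_snd, curvature_phaseProduct_snd]
    · rw [pair_curvature_phaseProduct_snd r hS, pair_curvature_phaseProduct_snd r hS, h]

variable {S r} in
/-- If the induced product is left symmetric and `ρ` is injective, then `r_#` preserves brackets. -/
theorem Delta_eq_zero_of_isLeftSymmetric (hρ : ∀ x, Function.Injective (ρ x))
    (hS : S.IsLeftSymmetric) (hT : (inducedProduct S r).IsLeftSymmetric) (α β : DualSec I F V) :
    Delta S r α β = 0 := by
  ext x
  refine hρ x ?_
  rw [ContMDiffSection.coe_zero, Pi.zero_apply, map_zero]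
  refine eq_zero_of_forall_mvfderiv_eq_zero x _ fun f => ?_
  have h : ρ.deriv (Delta S r α β) f = 0 := by
    rw [Delta, Anchor.deriv_sub_left, ← r.anchor_deriv, hT.deriv_commBracket,
      hS.deriv_commBracket, sub_eq_zero]
    rfl
  exact congrArg (fun g => g x) h

/-- The iterated product `T_α T_β γ` in terms of `S` and `r`. -/
theorem pair_inducedProduct_inducedProduct (α β γ : DualSec I F V) (X : Sec I F V) :
    pair (inducedProduct S r α (inducedProduct S r β γ)) X =
      tensorDeriv S (S X (r.sharp.app α)) r.eval β γ -
      tensorDeriv S (r.sharp.app (S.dual X α)) r.eval β γ +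
      tensorDeriv S X r.eval α (S.dual (r.sharp.app β) γ) +
      tensorDeriv₂ S (r.sharp.app α) X r.eval β γ +
      tensorDeriv S X r.eval (S.dual (r.sharp.app α) β) γ +
      tensorDeriv S X r.eval β (S.dual (r.sharp.app α) γ) +
      pair (S.dual (r.sharp.app α) (S.dual (r.sharp.app β) γ)) X := by
  rw [pair_inducedProduct, tensorDeriv_eval S r X α, pair_inducedProduct, tensorDeriv_sub_left,
    pair_dual S (r.sharp.app α) X (inducedProduct S r β γ), pair_inducedProduct,
    pair_inducedProduct, tensorDeriv_eval S r X α,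
    pair_dual S (r.sharp.app α) X (S.dual (r.sharp.app β) γ), tensorDeriv₂,
    tensorDeriv.eq_1 S (r.sharp.app α) (tensorDeriv S X r.eval)]
  simp only [Anchor.deriv_add, pair_sub_right]
  ring

/-- The covector `Y ↦ S_Y r(α, β) - S_Y r(β, α)`, twice the derivative of the skew part of `r`. -/
def skewDeriv (α β : DualSec I F V) : DualSec I F V :=
  commBracket (inducedProduct S r) α β - S.dual (r.sharp.app α) β + S.dual (r.sharp.app β) α

theorem pair_skewDeriv (α β : DualSec I F V) (X : Sec I F V) :
    pair (skewDeriv S r α β) X = tensorDeriv S X r.eval α β - tensorDeriv S X r.eval β α := by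
  simp only [skewDeriv, commBracket, pair_add_left, pair_sub_left, pair_inducedProduct]
  ring

theorem dual_skewDeriv
    (h : ∀ (X Y : Sec I F V) (α β : DualSec I F V), tensorDeriv₂ S X Y r.skewPart α β = 0)
    (X : Sec I F V) (α β : DualSec I F V) :
    S.dual X (skewDeriv S r α β) =
      skewDeriv S r (S.dual X α) β + skewDeriv S r α (S.dual X β) := dual_ext fun Y => by
  have h' := (tensorDeriv₂_skewPart_eq_zero_iff S r X Y α β).1 (h X Y α β)
  simp only [tensorDeriv₂, tensorDeriv.eq_1 S X] at h'
  simp only [pair_dual, pair_add_left, pair_skewDeriv, Anchor.deriv_sub]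
  linear_combination h'

theorem pair_Delta (α β γ : DualSec I F V) :
    pair γ (Delta S r α β) = r.eval (skewDeriv S r α β) γ -
      tensorDeriv S (r.sharp.app α) r.eval β γ + tensorDeriv S (r.sharp.app β) r.eval α γ := by
  have h : commBracket (inducedProduct S r) α β =
      skewDeriv S r α β + S.dual (r.sharp.app α) β - S.dual (r.sharp.app β) α := by
    rw [skewDeriv]; abel
  rw [Delta, h, pair_sub_right, r.pair_sharp, r.eval_sub_left, r.eval_add_left, tensorDeriv_eval,
    tensorDeriv_eval]
  simp only [commBracket, pair_sub_right, r.pair_sharp]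
  ring

variable {S r} in
theorem isLeftSymmetric_inducedProduct (hS : S.IsLeftSymmetric)
    (hΔ : ∀ α β : DualSec I F V, Delta S r α β = 0)
    (h : ∀ (X Y : Sec I F V) (α β : DualSec I F V), tensorDeriv₂ S X Y r.skewPart α β = 0) :
    (inducedProduct S r).IsLeftSymmetric := fun α β γ => dual_ext fun X => by
  have hE : ∀ α β γ, r.eval (skewDeriv S r α β) γ - tensorDeriv S (r.sharp.app α) r.eval β γ +
      tensorDeriv S (r.sharp.app β) r.eval α γ = 0 := fun α β γ => by
    rw [← pair_Delta, hΔ, pair_zero_right]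
  have hd := congrArg (ρ.deriv X) (hE α β γ)
  have h₁ := hE (S.dual X α) β γ
  have h₂ := hE α (S.dual X β) γ
  have h₃ := hE α β (S.dual X γ)
  have hk : tensorDeriv S X r.eval (skewDeriv S r α β) γ =
      ρ.deriv X (r.eval (skewDeriv S r α β) γ) -
      (r.eval (skewDeriv S r (S.dual X α) β) γ + r.eval (skewDeriv S r α (S.dual X β)) γ) -
      r.eval (skewDeriv S r α β) (S.dual X γ) := by
    rw [tensorDeriv, dual_skewDeriv S r h, r.eval_add_left]
  have hb : commBracket (inducedProduct S r) α β =
      skewDeriv S r α β + S.dual (r.sharp.app α) β - S.dual (r.sharp.app β) α := by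
    rw [skewDeriv]; abel
  have hbr : r.sharp.app (commBracket (inducedProduct S r) α β) =
      commBracket S (r.sharp.app α) (r.sharp.app β) := sub_eq_zero.1 (hΔ α β)
  have ht : tensorDeriv S X r.eval (commBracket (inducedProduct S r) α β) γ =
      tensorDeriv S X r.eval (skewDeriv S r α β) γ +
      tensorDeriv S X r.eval (S.dual (r.sharp.app α) β) γ -
      tensorDeriv S X r.eval (S.dual (r.sharp.app β) α) γ := by
    rw [hb]
    simp only [tensorDeriv, r.eval_add_left, r.eval_sub_left, dual_add_right, dual_sub_right,
      Anchor.deriv_add, Anchor.deriv_sub]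
    ring
  rw [pair_zero_left, curvature, pair_sub_left, pair_sub_left, pair_inducedProduct_inducedProduct,
    pair_inducedProduct_inducedProduct, pair_inducedProduct, hbr, hS.dual_commBracket,
    pair_sub_left, ht, hk, tensorDeriv₂_eval_comm r hS _ X, tensorDeriv₂_eval_comm r hS _ X]
  simp only [Anchor.deriv_sub, Anchor.deriv_add, Anchor.deriv_zero] at hd
  simp only [tensorDeriv₂, tensorDeriv.eq_1 S X (tensorDeriv S _ _)]
  linear_combination -hd + h₁ + h₂ + h₃

end Induced
end
end LSAlgebroid

theorem corollary4p1
    {E : Type*} [NormedAddCommGroup E] [NormedSpace ℝ E] [FiniteDimensional ℝ E]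
    {H : Type*} [TopologicalSpace H] (I : ModelWithCorners ℝ E H)
    {M : Type*} [TopologicalSpace M] [ChartedSpace H M] [IsManifold I ∞ M] [T2Space M]
    (F : Type*) [NormedAddCommGroup F] [NormedSpace ℝ F] [FiniteDimensional ℝ F]
    (V : M → Type*) [TopologicalSpace (TotalSpace F V)] [∀ x, AddCommGroup (V x)]
    [∀ x, Module ℝ (V x)] [∀ x, TopologicalSpace (V x)] [∀ x, IsTopologicalAddGroup (V x)]
    [∀ x, ContinuousSMul ℝ (V x)] [FiberBundle F V] [VectorBundle ℝ F V]
    [ContMDiffVectorBundle ∞ F V I]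
    (ρ : Anchor I F V) (hρ : ∀ x, Function.Injective (ρ x))
    (S : RightAnchoredProduct ρ) (hS : S.IsLeftSymmetric) (r : BiTensor I F V) :
    ((inducedProduct S r).IsLeftSymmetric ∧ IsCompatible S (inducedProduct S r)) ↔
      (∀ α β : DualSec I F V, Delta S r α β = 0) ∧
      (∀ (X Y : Sec I F V) (α β : DualSec I F V), tensorDeriv₂ S X Y r.skewPart α β = 0) := by
  rw [isCompatible_inducedProduct_iff r hS]
  exact ⟨fun h => ⟨Delta_eq_zero_of_isLeftSymmetric hρ hS h.1, h.2⟩,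
    fun h => ⟨isLeftSymmetric_inducedProduct hS h.1 h.2, h.2⟩⟩
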